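/- **Base category.** Let $\mathbb C$ be a complete, cocomplete and well-powered category in which strong epimorphisms are stable under pullback and which is locally distributive: every slice $\mathbb C/X$ has finite products and finite coproducts, and each functor $A\times(-)$ on $\mathbb C/X$ preserves finite coproducts. **Graphs and relations.** A graph $(X,R)$ is a parallel pair $\mathsf{outl}_R,\mathsf{outr}_R\colon R\to X$; it is a relation if the pair is jointly monic. A morphism $(X,R)\to(Y,S)$ is a pair $h_0\colon X\to Y$, $h_1\colon R\to S$ with $\mathsf{outl}_S h_1=h_0\,\mathsf{outl}_R$ and $\mathsf{outr}_S h_1=h_0\,\mathsf{outr}_R$. Write $\mathbf{Rel}$ for the category of relations, $(X,R)\le (X,S)$ if there is a morphism with $h_0=\mathrm{id}_X$, and $f_\star(X,R)=(Y,R,f\,\mathsf{outl}_R,f\,\mathsf{outr}_R)$ for $f\colon X\to Y$. The relation $(X,R)^\dagger$ generated by a graph is given by the (strong epi, mono)-factorization of $\langle \mathsf{outl}_R,\mathsf{outr}_R\rangle\colon R\to X\times X$. The composite $(X,R)\bullet(X,S)$ is $(-)^\dagger$ of the graph formed by the pullback of $\mathsf{outr}_R$ and $\mathsf{outl}_S$.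 In $\mathbf{Rel}$, products are $(X\times Y,R\times S)$ and coproducts are $(X,R)\vee(Y,S)=(X+Y,R+S)^\dagger$. $(X,X)$ is the identity relation, and $(X,R)$ is reflexive if $(X,X)\le(X,R)$. A relation lifting of an endofunctor $F$ (of a bifunctor $B\colon\mathbb C^{op}\times\mathbb C\to\mathbb C$) is a functor $\overline F\colon\mathbf{Rel}\to\mathbf{Rel}$ (resp. $\overline B\colon\mathbf{Rel}^{op}\times\mathbf{Rel}\to\mathbf{Rel}$) strictly over $F$ (resp. $B$) along $(X,R)\mapsto X$. The canonical lifting of $F$ is $\overline F(X,R)=(FX,FR)^\dagger$. **Data.** Fix 1. an object $V$ and a functor $\Sigma\cong V+\Sigma'\colon\mathbb C\to\mathbb C$ that preserves strong epimorphisms and has free algebras on all objects, with free monad $\Sigma^\star$ and initial algebra $\iota\colon\Sigma(\mu\Sigma)\to\mu\Sigma$. For a $\Sigma$-algebra $(A,a)$ let $\hat a\colon\Sigma^\star A\to A$ be the free extension of $\mathrm{id}_A$, and regard $A$ as $V$-pointed via $V\to\Sigma A\xrightarrow{a}A$; 2. a bifunctor $B\colon\mathbb C^{op}\times\mathbb C\to\mathbb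 C$ with, for all $X,Y$, preorders $\preceq$ on the hom-sets $\mathbb C(Z,B(X,Y))$, $Z\in\mathbb C$, stable under precomposition; and a relation lifting $\overline B$ of $B$ that is good for simulations, i.e. for all relations $(X,R),(Y,S),(Y,S')$: (G1) for each graph $(B(X,Y),T)$: if there is $h$ from $T$ to the edge object of $E=\overline B((X,R),(Y,S))$ with $\mathsf{outl}_E h=\mathsf{outl}_T$ and $\mathsf{outr}_E h\preceq\mathsf{outr}_T$, then $(B(X,Y),T)\le E$; (G2) $\overline B((X,X),(Y,Y))$ is reflexive; (G3) $\overline B((X,R),(Y,S))\bullet\overline B((X,X),(Y,S'))\le\overline B((X,R),(Y,S)\bullet(Y,S'))$; 3. a $V$-pointed higher-order GSOS law of $\Sigma$ over $B$, i.e. morphisms $\rho_{X,Y}\colon\Sigma(X\times B(X,Y))\to B(X,\Sigma^\star(X+Y))$ dinatural in $X\in V/\mathbb C$ and natural in $Y\in\mathbb C$, that admits a relation lifting: with $\overline\Sigma$ and $\overline{\Sigma^\star}$ the canonical liftings, for each relation $(X,R)$ with a $\mathbf{Rel}$-morphism $p\colon(V,V)\to(X,R)$ and each relation $(Y,S)$,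 the morphism $\rho_{X,Y}$ (with $X$ pointed by $p_0$) is the first component of a $\mathbf{Rel}$-morphism $\overline\Sigma\big((X,R)\times\overline B((X,R),(Y,S))\big)\to\overline B\big((X,R),\overline{\Sigma^\star}((X,R)\vee(Y,S))\big)$. **Notions.** For a $\Sigma$-algebra $(A,a)$ let $\rho_a=B(\mathrm{id},\hat a)\cdot B(\mathrm{id},\Sigma^\star\nabla)\cdot\rho_{A,A}\colon\Sigma(A\times B(A,A))\to B(A,A)$. The operational model $\gamma\colon\mu\Sigma\to B(\mu\Sigma,\mu\Sigma)$ is the unique morphism with $\gamma\cdot\iota=\rho_\iota\cdot\Sigma\langle\mathrm{id},\gamma\rangle$. For $c\colon A\to B(A,A)$, the triple $(A,a,c)$ is a lax $\rho$-bialgebra if $\rho_a\cdot\Sigma\langle\mathrm{id},c\rangle\preceq c\cdot a$. For a relation $(\mu\Sigma,R)$ let $E_R$ be the relation $\overline B((\mu\Sigma,\mu\Sigma),(\mu\Sigma,R))$ on $B(\mu\Sigma,\mu\Sigma)$. A morphism $\widetilde\gamma\colon\mu\Sigma\to B(\mu\Sigma,\mu\Sigma)$ is a weakening of $\gamma$ if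 for every relation $(\mu\Sigma,R)$ the following are equivalent: (i) $\widetilde\gamma_\star(\mu\Sigma,R)\le E_R$; (ii) there is $h\colon R\to E_R$ with $\mathsf{outl}_{E_R}h=\gamma\,\mathsf{outl}_R$ and $\mathsf{outr}_{E_R}h=\widetilde\gamma\,\mathsf{outr}_R$. Relations satisfying (i) and (ii) are weak simulations on $(\mu\Sigma,\gamma)$; weak similarity is the greatest weak simulation with respect to $\le$. A congruence on $(A,a)$ is a relation $(A,R)$ with $a_\star\overline\Sigma(A,R)\le(A,R)$. **Theorem (Compositionality).** Suppose that $\widetilde\gamma$ is a weakening of the operational model $(\mu\Sigma,\gamma)$ such that $(\mu\Sigma,\iota,\widetilde\gamma)$ is a lax $\rho$-bialgebra. Then the weak similarity relation on $(\mu\Sigma,\gamma)$ exists and is a congruence on $(\mu\Sigma,\iota)$. -/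

import Mathlib

open CategoryTheory CategoryTheory.Limits Opposite

universe v u

noncomputable section

namespace HOGSOS

/-! ### Assumptions on the base category -/

/-- A category is distributive if it has finite products and finite coproducts, and each functor
`X ⨯ -` preserves finite coproducts. -/
def IsDistributive (D : Type u) [Category.{v} D] : Prop :=
  ∃ (_ : HasFiniteProducts D) (_ : HasFiniteCoproducts D),
    ∀ X : D, PreservesFiniteCoproducts (prod.functor.obj X)

/-- A category is locally distributive if all its slice categories are distributive. -/
def IsLocallyDistributive (C : Type u) [Category.{v} C] : Prop :=
  ∀ X : C, IsDistributive (Over X)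

/-- Strong epimorphisms are stable under pullback. -/
def StrongEpisPullbackStable (C : Type u) [Category.{v} C] : Prop :=
  ∀ ⦃P X Y Z : C⦄ ⦃e' : P ⟶ X⦄ ⦃g : P ⟶ Y⦄ ⦃f : X ⟶ Z⦄ ⦃e : Y ⟶ Z⦄,
    IsPullback e' g f e → StrongEpi e → StrongEpi e'

/-- A functor preserves strong epimorphisms. -/
def PreservesStrongEpis {C : Type u} [Category.{v} C] (F : C ⥤ C) : Prop :=
  ∀ ⦃X Y : C⦄ (f : X ⟶ Y), StrongEpi f → StrongEpi (F.map f)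

/-- A complete well-powered category has (strong epi, mono)-factorizations. -/
instance (priority := 50) hasStrongEpiMonoFactorisations_of_wellPowered
    (C : Type u) [Category.{v} C] [HasLimits C] [WellPowered.{v} C] :
    HasStrongEpiMonoFactorisations C := by
  constructor
  intro X Y f
  let s : Set (Subobject Y) := {P | P.Factors f}
  let c : Cone (Subobject.wideCospan.{v} s) :=
    WidePullbackShape.mkCone f
      (fun j => Subobject.factorThru ((equivShrink.{v} (Subobject Y)).symm j.1) f (by
        obtain ⟨_, P, hP, rfl⟩ := j
        simpa [s] using hP))
      (fun j => Subobject.factorThru_arrow _ _ _)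
  let e : X ⟶ Subobject.widePullback.{v} s := limit.lift _ c
  have he : e ≫ Subobject.widePullbackι.{v} s = f := by
    exact limit.lift_π c none
  have hext : ExtremalEpi e := by
    refine ExtremalEpi.mk_of_hasEqualizers _ ?_
    intro Z p i hpi hi
    have hmono : Mono (i ≫ Subobject.widePullbackι.{v} s) := mono_comp _ _
    have hmem : Subobject.mk (i ≫ Subobject.widePullbackι.{v} s) ∈ s := by
      refine (Subobject.mk_factors_iff _ _).2 ⟨p, ?_⟩
      change p ≫ i ≫ Subobject.widePullbackι.{v} s = f
      rw [← Category.assoc, hpi, he]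
    have hle : Subobject.mk (Subobject.widePullbackι.{v} s) ≤
        Subobject.mk (i ≫ Subobject.widePullbackι.{v} s) := Subobject.sInf_le.{v} s _ hmem
    let k := Subobject.ofMkLEMk _ _ hle
    have hk : k ≫ i = 𝟙 _ := by
      rw [← cancel_mono (Subobject.widePullbackι.{v} s), Category.assoc,
        Subobject.ofMkLEMk_comp, Category.id_comp]
    exact ⟨k, by rw [← cancel_mono i, Category.assoc, hk, Category.comp_id, Category.id_comp], hk⟩
  have hstrong : StrongEpi e := (extremalEpi_iff_strongEpi_of_hasPullbacks e).1 hext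
  exact ⟨{ I := _, m := Subobject.widePullbackι.{v} s, e := e, fac := he }⟩

/-! ### Graphs and relations -/

section Graphs

variable {C : Type u} [Category.{v} C]

/-- A graph in `C` with object of vertices `X`. -/
structure GraphOver (X : C) where
  edge : C
  outl : edge ⟶ X
  outr : edge ⟶ X

/-- `IsGraphMap f R S`: the morphism `f` of vertices is the first component of a
graph morphism `(f, h)` from `(X, R)` to `(Y, S)`. -/
def IsGraphMap {X Y : C} (f : X ⟶ Y) (R : GraphOver X) (S : GraphOver Y) : Prop :=
  ∃ h : R.edge ⟶ S.edge, h ≫ S.outl = R.outl ≫ f ∧ h ≫ S.outr = R.outr ≫ f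

namespace GraphOver

/-- `R ≤ S` if there is a graph morphism from `R` to `S` that is the identity on vertices. -/
instance (X : C) : LE (GraphOver X) where
  le R S := ∃ h : R.edge ⟶ S.edge, h ≫ S.outl = R.outl ∧ h ≫ S.outr = R.outr

/-- Reindexing along `f : X ⟶ Y`. -/
@[simps]
def pushforward {X Y : C} (f : X ⟶ Y) (R : GraphOver X) : GraphOver Y :=
  ⟨R.edge, R.outl ≫ f, R.outr ≫ f⟩

/-- Composition of graphs, by pullback. -/
@[simps]
def comp [HasPullbacks C] {X : C} (R S : GraphOver X) : GraphOver X :=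
  ⟨pullback R.outr S.outl, pullback.fst _ _ ≫ R.outl, pullback.snd _ _ ≫ S.outr⟩

/-- The image of a graph under an endofunctor (the canonical graph lifting). -/
@[simps]
def map (F : C ⥤ C) {X : C} (R : GraphOver X) : GraphOver (F.obj X) :=
  ⟨F.obj R.edge, F.map R.outl, F.map R.outr⟩

/-- The coproduct of graphs, formed in `C`. -/
@[simps]
def coprod [HasBinaryCoproducts C] {X Y : C} (R : GraphOver X) (S : GraphOver Y) :
    GraphOver (X ⨿ Y) :=
  ⟨R.edge ⨿ S.edge, Limits.coprod.map R.outl S.outl, Limits.coprod.map R.outr S.outr⟩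

end GraphOver

/-- A relation on `X`: a graph whose two projections are jointly monic. -/
structure RelOver (X : C) extends GraphOver X where
  jointly_monic : ∀ ⦃Z : C⦄ (f g : Z ⟶ edge), f ≫ outl = g ≫ outl → f ≫ outr = g ≫ outr → f = g

namespace RelOver

instance (X : C) : LE (RelOver X) where
  le R S := R.toGraphOver ≤ S.toGraphOver

/-- The identity relation `(X, X)`. -/
@[simps! edge outl outr]
def diag (X : C) : RelOver X where
  edge := X
  outl := 𝟙 X
  outr := 𝟙 X
  jointly_monic := by intro Z f g h _; simpa using h

/-- The product of relations, formed in `C`. -/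
@[simps! edge outl outr]
def prod [HasBinaryProducts C] {X Y : C} (R : RelOver X) (S : RelOver Y) : RelOver (X ⨯ Y) where
  edge := R.edge ⨯ S.edge
  outl := Limits.prod.map R.outl S.outl
  outr := Limits.prod.map R.outr S.outr
  jointly_monic := by
    intro Z f g hl hr
    have hl1 := congrArg (· ≫ Limits.prod.fst) hl
    have hl2 := congrArg (· ≫ Limits.prod.snd) hl
    have hr1 := congrArg (· ≫ Limits.prod.fst) hr
    have hr2 := congrArg (· ≫ Limits.prod.snd) hr
    simp only [Category.assoc, Limits.prod.map_fst, Limits.prod.map_snd] at hl1 hl2 hr1 hr2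
    ext
    · exact R.jointly_monic _ _ (by simpa using hl1) (by simpa using hr1)
    · exact S.jointly_monic _ _ (by simpa using hl2) (by simpa using hr2)

end RelOver

section Factorisation

variable [HasBinaryProducts C] [HasStrongEpiMonoFactorisations C]

/-- The relation `R†` generated by a graph `R`, through the
(strong epi, mono)-factorization of `⟨outl, outr⟩ : R ⟶ X ⨯ X`. -/
@[simps! edge outl outr]
def GraphOver.dagger {X : C} (R : GraphOver X) : RelOver X where
  edge := image (Limits.prod.lift R.outl R.outr)
  outl := image.ι (Limits.prod.lift R.outl R.outr) ≫ Limits.prod.fst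
  outr := image.ι (Limits.prod.lift R.outl R.outr) ≫ Limits.prod.snd
  jointly_monic := by
    intro Z f g hl hr
    rw [← cancel_mono (image.ι (Limits.prod.lift R.outl R.outr))]
    ext
    · simpa using hl
    · simpa using hr

/-- The unit `R ⟶ R†` of the reflection. -/
def GraphOver.unit {X : C} (R : GraphOver X) : R.edge ⟶ R.dagger.edge :=
  factorThruImage (Limits.prod.lift R.outl R.outr)

instance {X : C} (R : GraphOver X) : StrongEpi R.unit := by
  unfold GraphOver.unit
  exact HasStrongEpiImages.strong_factorThruImage _

@[simp]
lemma GraphOver.unit_outl {X : C} (R : GraphOver X) : R.unit ≫ R.dagger.outl = R.outl := by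
  change factorThruImage (Limits.prod.lift R.outl R.outr) ≫
    image.ι (Limits.prod.lift R.outl R.outr) ≫ Limits.prod.fst = R.outl
  rw [image.fac_assoc, prod.lift_fst]

@[simp]
lemma GraphOver.unit_outr {X : C} (R : GraphOver X) : R.unit ≫ R.dagger.outr = R.outr := by
  change factorThruImage (Limits.prod.lift R.outl R.outr) ≫
    image.ι (Limits.prod.lift R.outl R.outr) ≫ Limits.prod.snd = R.outr
  rw [image.fac_assoc, prod.lift_snd]

/-- Graph morphisms into a relation extend along the reflection. -/
lemma IsGraphMap.of_dagger {X Y : C} {f : X ⟶ Y} {R : GraphOver X} {S : RelOver Y}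
    (h : IsGraphMap f R S.toGraphOver) : IsGraphMap f R.dagger.toGraphOver S.toGraphOver := by
  obtain ⟨h, hl, hr⟩ := h
  have : Mono (Limits.prod.lift S.outl S.outr) := ⟨fun a b hab => S.jointly_monic a b
    (by simpa [prod.lift_fst, prod.lift_snd] using congrArg (· ≫ Limits.prod.fst) hab)
    (by simpa [prod.lift_fst, prod.lift_snd] using congrArg (· ≫ Limits.prod.snd) hab)⟩
  have sq : CommSq h R.unit (Limits.prod.lift S.outl S.outr)
      (Limits.prod.lift (R.dagger.outl ≫ f) (R.dagger.outr ≫ f)) :=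
    ⟨by
      have h1 := R.unit_outl
      have h2 := R.unit_outr
      ext
      · rw [Category.assoc, Category.assoc, prod.lift_fst, prod.lift_fst, hl, ← h1, Category.assoc]
      · rw [Category.assoc, Category.assoc, prod.lift_snd, prod.lift_snd, hr, ← h2, Category.assoc]⟩
  refine ⟨sq.lift, ?_, ?_⟩
  · have := congrArg (· ≫ Limits.prod.fst) sq.fac_right
    simp only [Category.assoc, prod.lift_fst] at this
    exact this
  · have := congrArg (· ≫ Limits.prod.snd) sq.fac_right
    simp only [Category.assoc, prod.lift_snd] at this
    exact this

lemma IsGraphMap.dagger {X Y : C} {f : X ⟶ Y} {R : GraphOver X} {S : GraphOver Y}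
    (h : IsGraphMap f R S) : IsGraphMap f R.dagger.toGraphOver S.dagger.toGraphOver := by
  obtain ⟨h, hl, hr⟩ := h
  exact IsGraphMap.of_dagger ⟨h ≫ S.unit, by rw [Category.assoc, GraphOver.unit_outl, hl], by rw [Category.assoc, GraphOver.unit_outr, hr]⟩

namespace RelOver

/-- Composition of relations. -/
def comp [HasPullbacks C] {X : C} (R S : RelOver X) : RelOver X :=
  (R.toGraphOver.comp S.toGraphOver).dagger

/-- The coproduct `(X, R) ∨ (Y, S)` of relations in the category of relations. -/
def coprod [HasBinaryCoproducts C] {X Y : C} (R : RelOver X) (S : RelOver Y) : RelOver (X ⨿ Y) :=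
  (R.toGraphOver.coprod S.toGraphOver).dagger

end RelOver

end Factorisation

/-- A relation is reflexive if it contains the identity relation. -/
def RelOver.IsReflexive {X : C} (R : RelOver X) : Prop :=
  RelOver.diag X ≤ R

variable (C) in
/-- Relations in `C`, over a varying object. -/
structure Rel where
  base : C
  rel : RelOver base

namespace Rel

/-- A morphism of relations. -/
@[ext]
structure Hom (P Q : Rel C) where
  base : P.base ⟶ Q.base
  edge : P.rel.edge ⟶ Q.rel.edge
  outl : edge ≫ Q.rel.outl = P.rel.outl ≫ base
  outr : edge ≫ Q.rel.outr = P.rel.outr ≫ base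

instance : Category (Rel C) where
  Hom := Hom
  id P := ⟨𝟙 _, 𝟙 _, by simp, by simp⟩
  comp f g := ⟨f.base ≫ g.base, f.edge ≫ g.edge,
    by simp [g.outl, reassoc_of% f.outl], by simp [g.outr, reassoc_of% f.outr]⟩
  id_comp f := by apply Hom.ext <;> simp
  comp_id f := by apply Hom.ext <;> simp
  assoc f g h := by apply Hom.ext <;> simp

@[simp] lemma id_base (P : Rel C) : (𝟙 P : P ⟶ P).base = 𝟙 P.base := rfl

@[simp] lemma comp_base {P Q S : Rel C} (f : P ⟶ Q) (g : Q ⟶ S) :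
    (f ≫ g).base = f.base ≫ g.base := rfl

/-- Morphisms of relations are determined by their action on vertices. -/
lemma hom_ext {P Q : Rel C} {f g : P ⟶ Q} (h : f.base = g.base) : f = g :=
  Hom.ext h (Q.rel.jointly_monic _ _ (by rw [f.outl, g.outl, h]) (by rw [f.outr, g.outr, h]))

/-- The forgetful functor `(X, R) ↦ X`. -/
@[simps]
def forget : Rel C ⥤ C where
  obj P := P.base
  map f := f.base

lemma isGraphMap {P Q : Rel C} (f : P ⟶ Q) :
    IsGraphMap f.base P.rel.toGraphOver Q.rel.toGraphOver :=
  ⟨f.edge, f.outl, f.outr⟩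

/-- The morphism of relations over a given morphism of vertices. -/
def homMk {P Q : Rel C} (f : P.base ⟶ Q.base)
    (h : IsGraphMap f P.rel.toGraphOver Q.rel.toGraphOver) : P ⟶ Q :=
  ⟨f, h.choose, h.choose_spec.1, h.choose_spec.2⟩

@[simp] lemma homMk_base {P Q : Rel C} (f : P.base ⟶ Q.base)
    (h : IsGraphMap f P.rel.toGraphOver Q.rel.toGraphOver) : (homMk f h).base = f := rfl

/-- The identity relation `(X, X)` as an object of the category of relations. -/
@[simps]
def diag (X : C) : Rel C := ⟨X, RelOver.diag X⟩

/-- The product in the category of relations. -/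
@[simps]
def prod [HasBinaryProducts C] (P Q : Rel C) : Rel C := ⟨P.base ⨯ Q.base, P.rel.prod Q.rel⟩

/-- The coproduct in the category of relations. -/
@[simps]
def coprod [HasBinaryProducts C] [HasStrongEpiMonoFactorisations C] [HasBinaryCoproducts C]
    (P Q : Rel C) : Rel C := ⟨P.base ⨿ Q.base, P.rel.coprod Q.rel⟩

end Rel

end Graphs

/-! ### Relation liftings of functors -/

section Liftings

variable {C : Type u} [Category.{v} C]

/-- A relation lifting of an endofunctor `F`: a functor on relations strictly over `F`.
It is given by its action on relations and by the fact that `F` maps morphisms of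
relations to morphisms of relations; functoriality is automatic since a morphism of relations is
determined by its action on vertices. See `RelationLifting.toFunctor`. -/
structure RelationLifting (F : C ⥤ C) where
  obj : ∀ {X : C}, RelOver X → RelOver (F.obj X)
  map : ∀ {X Y : C} {R : RelOver X} {S : RelOver Y} (f : X ⟶ Y),
    IsGraphMap f R.toGraphOver S.toGraphOver →
      IsGraphMap (F.map f) (obj R).toGraphOver (obj S).toGraphOver

namespace RelationLifting

/-- The functor on the category of relations given by a relation lifting. -/
@[simps]
def toFunctor {F : C ⥤ C} (G : RelationLifting F) : Rel C ⥤ Rel C where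
  obj P := ⟨F.obj P.base, G.obj P.rel⟩
  map f := Rel.homMk (F.map f.base) (G.map f.base (Rel.isGraphMap f))
  map_id P := Rel.hom_ext (by simp)
  map_comp f g := Rel.hom_ext (by simp)

lemma toFunctor_comp_forget {F : C ⥤ C} (G : RelationLifting F) :
    G.toFunctor ⋙ Rel.forget = Rel.forget ⋙ F := rfl

end RelationLifting

/-- The canonical relation lifting `(X, R) ↦ (F X, F R)†`. -/
@[simps obj]
def canonicalLifting [HasBinaryProducts C] [HasStrongEpiMonoFactorisations C] (F : C ⥤ C) :
    RelationLifting F where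
  obj R := (R.toGraphOver.map F).dagger
  map := by
    rintro X Y R S f ⟨h, hl, hr⟩
    exact IsGraphMap.dagger ⟨F.map h,
      (F.map_comp _ _).symm.trans ((congrArg F.map hl).trans (F.map_comp _ _)),
      (F.map_comp _ _).symm.trans ((congrArg F.map hr).trans (F.map_comp _ _))⟩

/-- A relation lifting of a mixed-variance bifunctor `B : Cᵒᵖ × C ⟶ C` (in curried form): a
bifunctor on relations strictly over `B`, see `BifunctorLifting.toFunctor`. -/
structure BifunctorLifting (B : Cᵒᵖ ⥤ C ⥤ C) where
  obj : ∀ {X Y : C}, RelOver X → RelOver Y → RelOver ((B.obj (op X)).obj Y)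
  map : ∀ {X X' Y Y' : C} {R : RelOver X} {R' : RelOver X'} {S : RelOver Y} {S' : RelOver Y'}
    (f : X' ⟶ X) (g : Y ⟶ Y'),
    IsGraphMap f R'.toGraphOver R.toGraphOver → IsGraphMap g S.toGraphOver S'.toGraphOver →
      IsGraphMap ((B.map f.op).app Y ≫ (B.obj (op X')).map g)
        (obj R S).toGraphOver (obj R' S').toGraphOver

namespace BifunctorLifting

variable {B : Cᵒᵖ ⥤ C ⥤ C} (Bbar : BifunctorLifting B)

lemma isGraphMap_id {X : C} (R : GraphOver X) : IsGraphMap (𝟙 X) R R :=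
  ⟨𝟙 _, by simp, by simp⟩

/-- The bifunctor on the category of relations given by a relation lifting. -/
@[simps]
def toFunctor : (Rel C)ᵒᵖ ⥤ Rel C ⥤ Rel C where
  obj P :=
    { obj := fun Q => ⟨(B.obj (op P.unop.base)).obj Q.base, Bbar.obj P.unop.rel Q.rel⟩
      map := fun g => Rel.homMk ((B.obj (op P.unop.base)).map g.base) (by
        simpa using Bbar.map (𝟙 P.unop.base) g.base (isGraphMap_id P.unop.rel.toGraphOver)
          (Rel.isGraphMap g))
      map_id := fun Q => Rel.hom_ext (by simp)
      map_comp := fun f g => Rel.hom_ext (by simp) }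
  map f :=
    { app := fun Q => Rel.homMk ((B.map f.unop.base.op).app Q.base) (by
        simpa using Bbar.map f.unop.base (𝟙 Q.base) (Rel.isGraphMap f.unop)
          (isGraphMap_id Q.rel.toGraphOver))
      naturality := fun Q Q' g => Rel.hom_ext (by simp) }
  map_id P := by ext Q; exact Rel.hom_ext (by simp)
  map_comp f g := by ext Q; exact Rel.hom_ext (by simp)

lemma toFunctor_comp_forget :
    Bbar.toFunctor ⋙ (Functor.whiskeringRight _ _ _).obj Rel.forget =
      Rel.forget.op ⋙ B ⋙ (Functor.whiskeringLeft _ _ _).obj Rel.forget := rfl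

/-- The relation lifting `B̄((X, X), -)` of the endofunctor `B(X, -)`. -/
@[simps obj]
def atDiag (X : C) : RelationLifting (B.obj (op X)) where
  obj S := Bbar.obj (RelOver.diag X) S
  map f hf := by
    simpa using Bbar.map (𝟙 X) f (isGraphMap_id (RelOver.diag X).toGraphOver) hf

end BifunctorLifting

end Liftings

/-! ### Preorders -/

section Preorders

variable {C : Type u} [Category.{v} C]

/-- A preorder on an object `X`: a preorder on each hom-set `Y ⟶ X`, compatible with
precomposition. -/
structure ObjectPreorder (X : C) where
  le : ∀ {Y : C}, (Y ⟶ X) → (Y ⟶ X) → Prop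
  refl : ∀ {Y : C} (f : Y ⟶ X), le f f
  trans : ∀ {Y : C} (f g h : Y ⟶ X), le f g → le g h → le f h
  precomp : ∀ {Y Z : C} (h : Z ⟶ Y) (f g : Y ⟶ X), le f g → le (h ≫ f) (h ≫ g)

/-- `(X, R) ⪯ (X, S)`: there is a right-lax morphism from `R` to `S` that is the identity on
vertices. -/
def ObjectPreorder.LaxLE {X : C} (p : ObjectPreorder X) (R S : GraphOver X) : Prop :=
  ∃ h : R.edge ⟶ S.edge, h ≫ S.outl = R.outl ∧ p.le (h ≫ S.outr) R.outr

/-- A relation on a preordered object is good for simulations if right-lax morphisms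
into it can be turned into strict ones. -/
def ObjectPreorder.GoodForSimulations {X : C} (p : ObjectPreorder X) (S : RelOver X) : Prop :=
  ∀ R : GraphOver X, p.LaxLE R S.toGraphOver → R ≤ S.toGraphOver

/-- A preordered bifunctor: a preorder on each object `B(X, Y)`. -/
def BifunctorPreorder (B : Cᵒᵖ ⥤ C ⥤ C) :=
  ∀ X Y : C, ObjectPreorder ((B.obj (op X)).obj Y)

/-- A relation lifting of a preordered bifunctor is good for simulations. -/
structure BifunctorLifting.GoodForSimulations [HasPullbacks C] [HasBinaryProducts C]
    [HasStrongEpiMonoFactorisations C] {B : Cᵒᵖ ⥤ C ⥤ C}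
    (Bbar : BifunctorLifting B) (p : BifunctorPreorder B) : Prop where
  good : ∀ {X Y : C} (R : RelOver X) (S : RelOver Y), (p X Y).GoodForSimulations (Bbar.obj R S)
  reflexive : ∀ X Y : C, (Bbar.obj (RelOver.diag X) (RelOver.diag Y)).IsReflexive
  comp_le : ∀ {X Y : C} (R : RelOver X) (S S' : RelOver Y),
    (Bbar.obj R S).comp (Bbar.obj (RelOver.diag X) S') ≤ Bbar.obj R (S.comp S')

end Preorders

/-! ### Coalgebras, simulations and weak simulations -/

section Simulations

variable {C : Type u} [Category.{v} C] {F : C ⥤ C} (Fbar : RelationLifting F)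

/-- A relation `R` on `X` is a simulation on the coalgebra `c : X ⟶ F X` if
`c⋆ R ≤ F̄ R`. -/
def IsSimulation {X : C} (c : X ⟶ F.obj X) (R : RelOver X) : Prop :=
  R.toGraphOver.pushforward c ≤ (Fbar.obj R).toGraphOver

/-- There is a morphism from `R` to (the edges of) `F̄ R` that is compatible with `c` on the left
and with `c'` on the right. -/
def IsMixedSimulation {X : C} (c c' : X ⟶ F.obj X) (R : RelOver X) : Prop :=
  ∃ h : R.edge ⟶ (Fbar.obj R).edge,
    h ≫ (Fbar.obj R).outl = R.outl ≫ c ∧ h ≫ (Fbar.obj R).outr = R.outr ≫ c'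

/-- The coalgebra `c'` is a weakening of `c`. -/
def IsWeakening {X : C} (c c' : X ⟶ F.obj X) : Prop :=
  ∀ R : RelOver X, IsSimulation Fbar c' R ↔ IsMixedSimulation Fbar c c' R

/-- Weak simulations on `c` with respect to a weakening `c'`: the relations
that satisfy the two conditions which are equivalent by the definition of weakening. -/
def IsWeakSimulation {X : C} (c c' : X ⟶ F.obj X) (R : RelOver X) : Prop :=
  IsSimulation Fbar c' R ∧ IsMixedSimulation Fbar c c' R

/-- Weak similarity: the greatest weak simulation. -/
structure IsWeakSimilarity {X : C} (c c' : X ⟶ F.obj X) (R : RelOver X) : Prop where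
  isWeakSimulation : IsWeakSimulation Fbar c c' R
  le : ∀ S : RelOver X, IsWeakSimulation Fbar c c' S → S ≤ R

/-- A congruence on an algebra `(A, a)` for `F`: a relation `R` on `A` with
`a⋆ F̄ R ≤ R`, where `F̄` is the canonical relation lifting. -/
def IsCongruence [HasBinaryProducts C] [HasStrongEpiMonoFactorisations C]
    (A : Endofunctor.Algebra F) (R : RelOver A.a) : Prop :=
  ((canonicalLifting F).obj R).toGraphOver.pushforward A.str ≤ R.toGraphOver

end Simulations

/-! ### Higher-order GSOS laws -/

section Laws

variable {C : Type u} [Category.{v} C] [HasBinaryProducts C]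

section PrimitiveRecursion

variable {F : C ⥤ C} {I : Endofunctor.Algebra F}

/-- Primitive recursion on an initial algebra. -/
def primRec (hI : IsInitial I) {A : C} (a : F.obj (I.a ⨯ A) ⟶ A) : I.a ⟶ A :=
  (hI.to (⟨I.a ⨯ A, prod.lift (F.map prod.fst ≫ I.str) a⟩ : Endofunctor.Algebra F)).f ≫ prod.snd

/-- Primitive recursion yields the unique solution of its recursion equation. -/
lemma primRec_unique (hI : IsInitial I) {A : C} (a : F.obj (I.a ⨯ A) ⟶ A) (f : I.a ⟶ A) :
    I.str ≫ f = F.map (prod.lift (𝟙 _) f) ≫ a ↔ f = primRec hI a := by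
  let Q : Endofunctor.Algebra F := ⟨I.a ⨯ A, prod.lift (F.map prod.fst ≫ I.str) a⟩
  have hfst : (hI.to Q).f ≫ prod.fst = 𝟙 _ := by
    let p : Q ⟶ I := { f := prod.fst, h := (prod.lift_fst _ _).symm }
    exact congrArg Endofunctor.Algebra.Hom.f (hI.hom_ext (hI.to Q ≫ p) (𝟙 I))
  constructor
  · intro hf
    let g : I ⟶ Q :=
      { f := prod.lift (𝟙 _) f
        h := by
          change F.map (prod.lift (𝟙 _) f) ≫ prod.lift (F.map prod.fst ≫ I.str) a = _
          ext
          · rw [Category.assoc, Category.assoc, prod.lift_fst, prod.lift_fst, ← Category.assoc,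
              ← F.map_comp, prod.lift_fst, F.map_id, Category.id_comp, Category.comp_id]
          · rw [Category.assoc, Category.assoc, prod.lift_snd, prod.lift_snd, hf] }
    have h1 : prod.lift (𝟙 _) f = (hI.to Q).f :=
      congrArg Endofunctor.Algebra.Hom.f (hI.hom_ext g (hI.to Q))
    change f = (hI.to Q).f ≫ prod.snd
    rw [← h1, prod.lift_snd]
  · rintro rfl
    have hlift : prod.lift (𝟙 _) (primRec hI a) = (hI.to Q).f := by
      ext
      · rw [prod.lift_fst, hfst]
      · rw [prod.lift_snd]; rfl
    rw [hlift]
    have h1 : F.map (hI.to Q).f ≫ prod.lift (F.map prod.fst ≫ I.str) a = I.str ≫ (hI.to Q).f :=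
      (hI.to Q).h
    have h2 := congrArg (· ≫ prod.snd) h1
    simp only [Category.assoc, prod.lift_snd] at h2
    exact h2.symm

end PrimitiveRecursion

variable [HasBinaryCoproducts C]

/-- The free monad on `Sig`, as a functor, for a free-algebra functor `L`, that is, a left adjoint
of the forgetful functor from `Sig`-algebras. -/
abbrev freeMonad {Sig : C ⥤ C} (L : C ⥤ Endofunctor.Algebra Sig) : C ⥤ C :=
  L ⋙ Endofunctor.Algebra.forget Sig

/-- The evaluation morphism `â : Σ⋆ A ⟶ A` of an algebra `(A, a)`: the extension of the identity
of `A` to the free algebra. -/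
def evalAlg {Sig : C ⥤ C} {L : C ⥤ Endofunctor.Algebra Sig}
    (adj : L ⊣ Endofunctor.Algebra.forget Sig) (A : Endofunctor.Algebra Sig) :
    (freeMonad L).obj A.a ⟶ A.a :=
  (adj.counit.app A).f

/-- A `V`-pointed higher-order GSOS law of `Sig` over `B`: morphisms
`Σ(X ⨯ B(X, Y)) ⟶ B(X, Σ⋆(X + Y))`, dinatural in the `V`-pointed object `X` and natural in `Y`. -/
structure Law (V : C) (Sig : C ⥤ C) (L : C ⥤ Endofunctor.Algebra Sig) (B : Cᵒᵖ ⥤ C ⥤ C) where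
  app : ∀ (X : Under V) (Y : C), Sig.obj (X.right ⨯ (B.obj (op X.right)).obj Y) ⟶
    (B.obj (op X.right)).obj ((freeMonad L).obj (X.right ⨿ Y))
  natural : ∀ (X : Under V) {Y Y' : C} (g : Y ⟶ Y'),
    Sig.map (prod.map (𝟙 X.right) ((B.obj (op X.right)).map g)) ≫ app X Y' =
      app X Y ≫ (B.obj (op X.right)).map ((freeMonad L).map (coprod.map (𝟙 X.right) g))
  dinatural : ∀ {X X' : Under V} (h : X ⟶ X') (Y : C),
    Sig.map (prod.map (𝟙 X.right) ((B.map h.right.op).app Y)) ≫ app X Y ≫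
        (B.obj (op X.right)).map ((freeMonad L).map (coprod.map h.right (𝟙 Y))) =
      Sig.map (prod.map h.right (𝟙 ((B.obj (op X'.right)).obj Y))) ≫ app X' Y ≫
        (B.map h.right.op).app ((freeMonad L).obj (X'.right ⨿ Y))

/-- Every algebra `(A, a)` for `Sig = V + Sig'` is `V`-pointed, by
`V ⟶ V + Sig' A = Sig A ⟶ A`. -/
def pointed {V : C} {Sig Sig' : C ⥤ C} (e : Sig ≅ (Functor.const C).obj V ⨿ Sig')
    (A : Endofunctor.Algebra Sig) : Under V :=
  Under.mk ((((coprod.inl : (Functor.const C).obj V ⟶ _) ≫ e.inv).app A.a ≫ A.str : V ⟶ A.a))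

namespace Law

variable {V : C} {Sig Sig' : C ⥤ C} {L : C ⥤ Endofunctor.Algebra Sig} {B : Cᵒᵖ ⥤ C ⥤ C}

/-- The composite `Σ(A ⨯ B(A, A)) ⟶ B(A, Σ⋆(A + A)) ⟶ B(A, Σ⋆ A) ⟶ B(A, A)` of the law, the
codiagonal and evaluation in the algebra `A`. -/
def step (e : Sig ≅ (Functor.const C).obj V ⨿ Sig') (adj : L ⊣ Endofunctor.Algebra.forget Sig)
    (ρ : Law V Sig L B) (A : Endofunctor.Algebra Sig) :
    Sig.obj (A.a ⨯ (B.obj (op A.a)).obj A.a) ⟶ (B.obj (op A.a)).obj A.a :=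
  ρ.app (pointed e A) A.a ≫
    (B.obj (op A.a)).map ((freeMonad L).map (coprod.desc (𝟙 A.a) (𝟙 A.a))) ≫
    (B.obj (op A.a)).map (evalAlg adj A)

/-- The operational model `γ : μΣ ⟶ B(μΣ, μΣ)`, by primitive recursion. -/
def operationalModel (e : Sig ≅ (Functor.const C).obj V ⨿ Sig')
    (adj : L ⊣ Endofunctor.Algebra.forget Sig) (ρ : Law V Sig L B)
    {I : Endofunctor.Algebra Sig} (hI : IsInitial I) : I.a ⟶ (B.obj (op I.a)).obj I.a :=
  primRec hI (ρ.step e adj I)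

/-- The lax bialgebra condition for an algebra `A` and a coalgebra `c : A ⟶ B(A, A)`. -/
def IsLaxBialgebra (e : Sig ≅ (Functor.const C).obj V ⨿ Sig')
    (adj : L ⊣ Endofunctor.Algebra.forget Sig) (ρ : Law V Sig L B) (p : BifunctorPreorder B)
    (A : Endofunctor.Algebra Sig) (c : A.a ⟶ (B.obj (op A.a)).obj A.a) : Prop :=
  (p A.a A.a).le (Sig.map (prod.lift (𝟙 A.a) c) ≫ ρ.step e adj A) (A.str ≫ c)

/-- A relation lifting of a law: morphisms of relations
`Σ̄(P ⨯ B̄(P, Q)) ⟶ B̄(P, Σ̄⋆(P ∨ Q))` over the components of the law, for relations `Q` and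
`(V, V)`-pointed relations `P`. Here `Σ̄` is the canonical lifting of `Σ`, and `Σ̄⋆` is
the canonical lifting of `Σ⋆`. Naturality in `Q` and dinaturality in `P` need not be required: they
follow from those of the law, since morphisms of relations are determined by their action on
vertices (`Rel.hom_ext`). -/
structure Lifting [HasStrongEpiMonoFactorisations C] (ρ : Law V Sig L B)
    (Bbar : BifunctorLifting B) where
  app : ∀ (P : Under (Rel.diag V)) (Q : Rel C),
    (canonicalLifting Sig).toFunctor.obj
        (P.right.prod ((Bbar.toFunctor.obj (op P.right)).obj Q)) ⟶
      (Bbar.toFunctor.obj (op P.right)).obj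
        ((canonicalLifting (freeMonad L)).toFunctor.obj (P.right.coprod Q))
  app_base : ∀ (P : Under (Rel.diag V)) (Q : Rel C),
    (app P Q).base = ρ.app (Under.mk (Y := P.right.base) P.hom.base) Q.base

end Law

end Laws

end HOGSOS

end

/-!
# Weak similarity is a congruence

Relations on a fixed object form a complete lattice up to equivalence of preorders, because they
are subobjects of `X ⨯ X`. Weak simulations are the post-fixed points of the monotone operator
`S ↦ (γ' ⨯ γ')⁻¹ (B̄ (1, S))`, where `1` is the identity relation, so weak similarity `R` is its
greatest fixed point. It is reflexive and transitive by the reflexivity and composition laws of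
`B̄`.

The congruence property is an instance of Howe's method. The *Howe closure* `H` of `R` is the least
relation with `ι⋆ (Σ̄ H) • R ≤ H`. Since `R` is a preorder, `H` is a congruence, contains `R`,
satisfies `H • R ≤ H`, and is reflexive by initiality of `μΣ`.

The key point is that `H` relates `γ` on the left to `γ'` on the right inside `B̄ (H, H)`. By
minimality of `H` it suffices that the part `P` of `H` where this holds is again closed under
`P ↦ ι⋆ (Σ̄ P) • R`. On `ι⋆ (Σ̄ P)` the lifting of the law relates `γ · ι` to
`ρ_ι · Σ⟨id, γ'⟩`, which by the lax bialgebra condition lies below `γ' · ι`, and goodness of `B̄`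
turns this into a strict relationship (`relatesAlong_compatibleGraph_of_isLaxBialgebra`). Composing
with the simulation `R` on the right uses `B̄ (H, H) • B̄ (1, R) ≤ B̄ (H, H • R) ≤ B̄ (H, H)`.

As `H` is reflexive, `B̄ (H, H) ≤ B̄ (1, H)`, so `H` is a weak simulation and is contained in `R`.
Thus `H` and `R` coincide, and `R` is a congruence because `H` is.
-/

noncomputable section

namespace HOGSOS

section RelatesAlong

attribute [local simp] prod.lift_fst prod.lift_snd prod.lift_fst_assoc prod.lift_snd_assoc
  pullback.lift_fst pullback.lift_snd pullback.lift_fst_assoc pullback.lift_snd_assoc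

variable {C : Type u} [Category.{v} C]

/-! ### Graphs related along a pair of morphisms -/

instance RelOver.mono_lift [HasBinaryProducts C] {X : C} (R : RelOver X) :
    Mono (Limits.prod.lift R.outl R.outr) :=
  ⟨fun a b hab => R.jointly_monic a b
    (by simpa using congrArg (· ≫ Limits.prod.fst) hab)
    (by simpa using congrArg (· ≫ Limits.prod.snd) hab)⟩

namespace GraphOver

/-- The projections of the composite of two graphs. -/
lemma exists_comp_proj [HasPullbacks C] {X : C} (R S : GraphOver X) :
    ∃ (x : (R.comp S).edge ⟶ R.edge) (y : (R.comp S).edge ⟶ S.edge),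
      x ≫ R.outr = y ≫ S.outl ∧ x ≫ R.outl = (R.comp S).outl ∧ y ≫ S.outr = (R.comp S).outr :=
  ⟨pullback.fst _ _, pullback.snd _ _, pullback.condition, rfl, rfl⟩

/-- Matching pairs of edges are edges of the composite. -/
lemma exists_comp_lift [HasPullbacks C] {X E : C} (R S : GraphOver X) (x : E ⟶ R.edge)
    (y : E ⟶ S.edge) (h : x ≫ R.outr = y ≫ S.outl) :
    ∃ k : E ⟶ (R.comp S).edge,
      k ≫ (R.comp S).outl = x ≫ R.outl ∧ k ≫ (R.comp S).outr = y ≫ S.outr :=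
  ⟨pullback.lift x y h, pullback.lift_fst_assoc _ _ _ _, pullback.lift_snd_assoc _ _ _ _⟩

end GraphOver

/-- The graph `R` is mapped into `S` by `f` on left endpoints and by `g` on right endpoints. The
case `f = g` is `IsGraphMap`, and mixed simulations are the case of a coalgebra and a weakening. -/
def RelatesAlong {X Y : C} (f g : X ⟶ Y) (R : GraphOver X) (S : GraphOver Y) : Prop :=
  ∃ h : R.edge ⟶ S.edge, h ≫ S.outl = R.outl ≫ f ∧ h ≫ S.outr = R.outr ≫ g

namespace RelatesAlong

variable {X Y Z : C} {f g : X ⟶ Y} {R : GraphOver X} {S : GraphOver Y}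

lemma trans {f' g' : Y ⟶ Z} {T : GraphOver Z} (h : RelatesAlong f g R S)
    (h' : RelatesAlong f' g' S T) : RelatesAlong (f ≫ f') (g ≫ g') R T := by
  obtain ⟨a, al, ar⟩ := h
  obtain ⟨b, bl, br⟩ := h'
  exact ⟨a ≫ b, by rw [Category.assoc, bl, reassoc_of% al],
    by rw [Category.assoc, br, reassoc_of% ar]⟩

lemma of_le {R S : GraphOver X} (h : R ≤ S) : RelatesAlong (𝟙 X) (𝟙 X) R S := by
  obtain ⟨a, al, ar⟩ := h
  exact ⟨a, by simpa using al, by simpa using ar⟩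

lemma trans_le {S' : GraphOver Y} (h : RelatesAlong f g R S) (h' : S ≤ S') :
    RelatesAlong f g R S' := by
  simpa using h.trans (of_le h')

lemma le_trans {R' : GraphOver X} (h' : R' ≤ R) (h : RelatesAlong f g R S) :
    RelatesAlong f g R' S := by
  simpa using (of_le h').trans h

lemma le {R S : GraphOver X} (h : RelatesAlong (𝟙 X) (𝟙 X) R S) : R ≤ S := by
  obtain ⟨a, al, ar⟩ := h
  exact ⟨a, by simpa using al, by simpa using ar⟩

/-- A graph related to a relation after precomposing its edges with a strong epimorphism was
already related to it. -/
lemma of_strongEpi [HasBinaryProducts C] {S : RelOver Y} {E : C} (q : E ⟶ R.edge) [StrongEpi q]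
    (h : RelatesAlong f g ⟨E, q ≫ R.outl, q ≫ R.outr⟩ S.toGraphOver) :
    RelatesAlong f g R S.toGraphOver := by
  obtain ⟨h, hl, hr⟩ := h
  have sq : CommSq h q (Limits.prod.lift S.outl S.outr)
      (Limits.prod.lift (R.outl ≫ f) (R.outr ≫ g)) :=
    ⟨by
      ext
      · simpa using hl
      · simpa using hr⟩
  refine ⟨sq.lift, ?_, ?_⟩
  · simpa using congrArg (· ≫ Limits.prod.fst) sq.fac_right
  · simpa using congrArg (· ≫ Limits.prod.snd) sq.fac_right

lemma of_dagger [HasBinaryProducts C] [HasStrongEpiMonoFactorisations C] {S : RelOver Y}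
    (h : RelatesAlong f g R S.toGraphOver) :
    RelatesAlong f g R.dagger.toGraphOver S.toGraphOver := by
  apply of_strongEpi R.unit
  rwa [GraphOver.unit_outl, GraphOver.unit_outr]

lemma pushforward (f : X ⟶ Y) (R : GraphOver X) : RelatesAlong f f R (R.pushforward f) :=
  ⟨𝟙 _, Category.id_comp _, Category.id_comp _⟩

lemma diag (f : X ⟶ Y) :
    RelatesAlong f f (RelOver.diag X).toGraphOver (RelOver.diag Y).toGraphOver :=
  ⟨f, (Category.comp_id f).trans (Category.id_comp f).symm,
    (Category.comp_id f).trans (Category.id_comp f).symm⟩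

lemma map (F : C ⥤ C) (h : RelatesAlong f g R S) :
    RelatesAlong (F.map f) (F.map g) (R.map F) (S.map F) := by
  obtain ⟨a, al, ar⟩ := h
  exact ⟨F.map a,
    (F.map_comp _ _).symm.trans ((congrArg F.map al).trans (F.map_comp _ _)),
    (F.map_comp _ _).symm.trans ((congrArg F.map ar).trans (F.map_comp _ _))⟩

lemma prodLift [HasBinaryProducts C] {f' g' : X ⟶ Z} {S : RelOver Y} {T : RelOver Z}
    (h : RelatesAlong f g R S.toGraphOver) (h' : RelatesAlong f' g' R T.toGraphOver) :
    RelatesAlong (prod.lift f f') (prod.lift g g') R (S.prod T).toGraphOver := by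
  obtain ⟨a, al, ar⟩ := h
  obtain ⟨b, bl, br⟩ := h'
  exact ⟨prod.lift a b,
    (prod.lift_map _ _ _ _).trans (by rw [al, bl, prod.comp_lift]),
    (prod.lift_map _ _ _ _).trans (by rw [ar, br, prod.comp_lift])⟩

lemma comp [HasPullbacks C] {k : X ⟶ Y} {R' : GraphOver X} {S' : GraphOver Y}
    (h : RelatesAlong f g R S) (h' : RelatesAlong g k R' S') :
    RelatesAlong f k (R.comp R') (S.comp S') := by
  obtain ⟨a, al, ar⟩ := h
  obtain ⟨b, bl, br⟩ := h'
  obtain ⟨x, y, hxy, hx, hy⟩ := R.exists_comp_proj R'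
  obtain ⟨k, kl, kr⟩ := S.exists_comp_lift S' (x ≫ a) (y ≫ b) (by simp [ar, bl, reassoc_of% hxy])
  exact ⟨k, by rw [kl, ← hx]; simp [al], by rw [kr, ← hy]; simp [br]⟩

end RelatesAlong

lemma GraphOver.le_dagger [HasBinaryProducts C] [HasStrongEpiMonoFactorisations C] {X : C}
    (R : GraphOver X) : R ≤ R.dagger.toGraphOver :=
  ⟨R.unit, R.unit_outl, R.unit_outr⟩

lemma GraphOver.dagger_le [HasBinaryProducts C] [HasStrongEpiMonoFactorisations C] {X : C}
    {R : GraphOver X} {S : RelOver X} (h : R ≤ S.toGraphOver) : R.dagger ≤ S :=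
  (RelatesAlong.of_le h).of_dagger.le

/-! ### The lattice of relations -/

namespace GraphOver

instance (X : C) : Preorder (GraphOver X) where
  le_refl R := ⟨𝟙 _, by simp, by simp⟩
  le_trans _ _ _ h h' := ((RelatesAlong.of_le h).trans_le h').le

lemma pushforward_le_iff {X Y : C} {f : X ⟶ Y} {R : GraphOver X} {S : GraphOver Y} :
    R.pushforward f ≤ S ↔ RelatesAlong f f R S := Iff.rfl

lemma comp_mono [HasPullbacks C] {X : C} {R R' S S' : GraphOver X} (h : R ≤ R') (h' : S ≤ S') :
    R.comp S ≤ R'.comp S' :=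
  ((RelatesAlong.of_le h).comp (RelatesAlong.of_le h')).le

lemma comp_assoc_le [HasPullbacks C] {X : C} (R S T : GraphOver X) :
    (R.comp S).comp T ≤ R.comp (S.comp T) := by
  obtain ⟨x, t, hxt, hx, ht⟩ := (R.comp S).exists_comp_proj T
  obtain ⟨r, s, hrs, hr, hs⟩ := R.exists_comp_proj S
  obtain ⟨k, kl, kr⟩ := S.exists_comp_lift T (x ≫ s) t (by rw [Category.assoc, hs, hxt])
  obtain ⟨m, ml, mr⟩ := R.exists_comp_lift (S.comp T) (x ≫ r) k
    (by rw [kl, Category.assoc, hrs, Category.assoc])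
  exact ⟨m, by rw [ml, Category.assoc, hr, hx], by rw [mr, kr, ht]⟩

lemma le_comp_of_diag_le_left [HasPullbacks C] {X : C} {R : GraphOver X}
    (h : (RelOver.diag X).toGraphOver ≤ R) (S : GraphOver X) : S ≤ R.comp S := by
  obtain ⟨d, dl, dr⟩ : ∃ d : X ⟶ R.edge, d ≫ R.outl = 𝟙 X ∧ d ≫ R.outr = 𝟙 X := h
  obtain ⟨k, kl, kr⟩ := R.exists_comp_lift S (S.outl ≫ d) (𝟙 _) (by simp [dr])
  exact ⟨k, by simpa [dl] using kl, by simpa using kr⟩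

lemma le_comp_of_diag_le_right [HasPullbacks C] {X : C} {S : GraphOver X}
    (h : (RelOver.diag X).toGraphOver ≤ S) (R : GraphOver X) : R ≤ R.comp S := by
  obtain ⟨d, dl, dr⟩ : ∃ d : X ⟶ S.edge, d ≫ S.outl = 𝟙 X ∧ d ≫ S.outr = 𝟙 X := h
  obtain ⟨k, kl, kr⟩ := R.exists_comp_lift S (𝟙 _) (R.outr ≫ d) (by simp [dl])
  exact ⟨k, by simpa using kl, by simpa [dr] using kr⟩

/-- A relation containing `R • T` contains `R† • T`; it is here that strong epimorphisms have to be
stable under pullback. -/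
lemma dagger_comp_le [HasBinaryProducts C] [HasStrongEpiMonoFactorisations C] [HasPullbacks C]
    (hepi : StrongEpisPullbackStable C) {X : C} {R T : GraphOver X} {U : RelOver X}
    (h : R.comp T ≤ U.toGraphOver) : R.dagger.toGraphOver.comp T ≤ U.toGraphOver := by
  -- The pullback of the unit `R ⟶ R†` covers `R† • T` by edges of `R • T`.
  let a : (R.dagger.toGraphOver.comp T).edge ⟶ R.dagger.edge := pullback.fst _ _
  let b : (R.dagger.toGraphOver.comp T).edge ⟶ T.edge := pullback.snd _ _
  have hab : a ≫ R.dagger.outr = b ≫ T.outl := pullback.condition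
  have : StrongEpi (pullback.fst a R.unit) :=
    hepi (IsPullback.of_hasPullback a R.unit) inferInstance
  apply RelatesAlong.le
  apply RelatesAlong.of_strongEpi (pullback.fst a R.unit)
  obtain ⟨k, kl, kr⟩ := R.exists_comp_lift T (pullback.snd a R.unit) (pullback.fst a R.unit ≫ b)
    (by rw [Category.assoc, ← hab, pullback.condition_assoc, GraphOver.unit_outr])
  refine RelatesAlong.le_trans ⟨k, ?_, ?_⟩ (RelatesAlong.of_le h)
  · rw [kl]
    change _ = pullback.fst a R.unit ≫ a ≫ R.dagger.outl
    rw [pullback.condition_assoc, GraphOver.unit_outl]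
  · rw [kr, Category.assoc]
    rfl

end GraphOver

namespace RelOver

instance (X : C) : Preorder (RelOver X) :=
  Preorder.lift RelOver.toGraphOver

/-- A relation on `X` as a subobject of `X ⨯ X`. -/
def toSubobject [HasBinaryProducts C] {X : C} (R : RelOver X) : Subobject (X ⨯ X) :=
  Subobject.mk (Limits.prod.lift R.outl R.outr)

/-- A subobject of `X ⨯ X` as a relation on `X`. -/
@[simps! edge outl outr]
def ofSubobject [HasBinaryProducts C] {X : C} (P : Subobject (X ⨯ X)) : RelOver X where
  edge := P
  outl := P.arrow ≫ Limits.prod.fst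
  outr := P.arrow ≫ Limits.prod.snd
  jointly_monic := by
    intro Z f g hl hr
    rw [← cancel_mono P.arrow]
    ext
    · simpa using hl
    · simpa using hr

lemma ofSubobject_mono [HasBinaryProducts C] {X : C} {P Q : Subobject (X ⨯ X)} (h : P ≤ Q) :
    ofSubobject P ≤ ofSubobject Q :=
  ⟨Subobject.ofLE P Q h, Subobject.ofLE_arrow_assoc h _, Subobject.ofLE_arrow_assoc h _⟩

lemma toSubobject_mono [HasBinaryProducts C] {X : C} {R S : RelOver X} (h : R ≤ S) :
    R.toSubobject ≤ S.toSubobject := by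
  obtain ⟨h, hl, hr⟩ := h
  exact Subobject.mk_le_mk_of_comm h (by ext <;> simp [hl, hr])

lemma le_ofSubobject_toSubobject [HasBinaryProducts C] {X : C} (R : RelOver X) :
    R ≤ ofSubobject R.toSubobject := by
  have h := Subobject.underlyingIso_arrow (Limits.prod.lift R.outl R.outr)
  exact ⟨(Subobject.underlyingIso (Limits.prod.lift R.outl R.outr)).inv,
    ((Category.assoc _ _ _).symm.trans (congrArg (· ≫ Limits.prod.fst) h)).trans
      (prod.lift_fst _ _),
    ((Category.assoc _ _ _).symm.trans (congrArg (· ≫ Limits.prod.snd) h)).trans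
      (prod.lift_snd _ _)⟩

lemma ofSubobject_toSubobject_le [HasBinaryProducts C] {X : C} (R : RelOver X) :
    ofSubobject R.toSubobject ≤ R := by
  have h := Subobject.underlyingIso_hom_comp_eq_mk (Limits.prod.lift R.outl R.outr)
  exact ⟨(Subobject.underlyingIso (Limits.prod.lift R.outl R.outr)).hom,
    ((congrArg (_ ≫ ·) (prod.lift_fst R.outl R.outr)).symm.trans (Category.assoc _ _ _).symm).trans
      (congrArg (· ≫ Limits.prod.fst) h),
    ((congrArg (_ ≫ ·) (prod.lift_snd R.outl R.outr)).symm.trans (Category.assoc _ _ _).symm).trans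
      (congrArg (· ≫ Limits.prod.snd) h)⟩

/-- The complete lattice of subobjects, obtained from intersections alone. The instance in Mathlib
needs in addition that morphisms out of an initial object are monic. -/
abbrev subobjectCompleteLattice [HasLimits C] [WellPowered.{v} C] (X : C) :
    CompleteLattice (Subobject X) :=
  let _ := Subobject.completeSemilatticeInf.{v} (B := X)
  completeLatticeOfCompleteSemilatticeInf _

/-- Knaster–Tarski for relations: a monotone operator has a least pre-fixed point. -/
lemma exists_least_prefixed [HasLimits C] [WellPowered.{v} C] {X : C}
    (Φ : RelOver X → RelOver X) (hΦ : Monotone Φ) :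
    ∃ H : RelOver X, Φ H ≤ H ∧ H ≤ Φ H ∧ ∀ S, Φ S ≤ S → H ≤ S := by
  let _ := subobjectCompleteLattice (X ⨯ X)
  let Ψ : Subobject (X ⨯ X) →o Subobject (X ⨯ X) :=
    ⟨fun P => (Φ (ofSubobject P)).toSubobject,
      fun P Q h => toSubobject_mono (hΦ (ofSubobject_mono h))⟩
  have hfix : (Φ (ofSubobject Ψ.lfp)).toSubobject = Ψ.lfp := Ψ.map_lfp
  refine ⟨ofSubobject Ψ.lfp, ?_, ?_, fun S hS => ?_⟩
  · exact (le_ofSubobject_toSubobject _).trans (ofSubobject_mono hfix.le)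
  · exact (ofSubobject_mono hfix.ge).trans (ofSubobject_toSubobject_le _)
  · have : Ψ.lfp ≤ S.toSubobject :=
      Ψ.lfp_le (toSubobject_mono ((hΦ (ofSubobject_toSubobject_le S)).trans hS))
    exact (ofSubobject_mono this).trans (ofSubobject_toSubobject_le S)

/-- Knaster–Tarski for relations: a monotone operator has a greatest post-fixed point. -/
lemma exists_greatest_postfixed [HasLimits C] [WellPowered.{v} C] {X : C}
    (Φ : RelOver X → RelOver X) (hΦ : Monotone Φ) :
    ∃ R : RelOver X, R ≤ Φ R ∧ ∀ S, S ≤ Φ S → S ≤ R := by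
  let _ := subobjectCompleteLattice (X ⨯ X)
  let Ψ : Subobject (X ⨯ X) →o Subobject (X ⨯ X) :=
    ⟨fun P => (Φ (ofSubobject P)).toSubobject,
      fun P Q h => toSubobject_mono (hΦ (ofSubobject_mono h))⟩
  have hfix : (Φ (ofSubobject Ψ.gfp)).toSubobject = Ψ.gfp := Ψ.map_gfp
  refine ⟨ofSubobject Ψ.gfp, ?_, fun S hS => ?_⟩
  · exact (ofSubobject_mono hfix.ge).trans (ofSubobject_toSubobject_le _)
  · have : S.toSubobject ≤ Ψ.gfp :=
      Ψ.le_gfp (toSubobject_mono (hS.trans (hΦ (le_ofSubobject_toSubobject S))))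
    exact (le_ofSubobject_toSubobject S).trans (ofSubobject_mono this)

/-- The meet of a relation with an inverse image: the part of the relation `R` that is
mapped into `S` by `f` on left endpoints and by `g` on right endpoints. -/
lemma exists_restriction [HasLimits C] {X Y : C} (f g : X ⟶ Y) (R : RelOver X) (S : RelOver Y) :
    ∃ P : RelOver X, P ≤ R ∧ RelatesAlong f g P.toGraphOver S.toGraphOver ∧
      ∀ Q : GraphOver X, Q ≤ R.toGraphOver → RelatesAlong f g Q S.toGraphOver →
        Q ≤ P.toGraphOver := by
  let a := Limits.prod.lift (R.outl ≫ f) (R.outr ≫ g)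
  let b := Limits.prod.lift S.outl S.outr
  have hfst : pullback.fst a b ≫ R.outl ≫ f = pullback.snd a b ≫ S.outl := by
    simpa [a, b] using congrArg (· ≫ Limits.prod.fst) (pullback.condition (f := a) (g := b))
  have hsnd : pullback.fst a b ≫ R.outr ≫ g = pullback.snd a b ≫ S.outr := by
    simpa [a, b] using congrArg (· ≫ Limits.prod.snd) (pullback.condition (f := a) (g := b))
  have : Mono b := inferInstanceAs (Mono (Limits.prod.lift S.outl S.outr))
  refine ⟨⟨⟨pullback a b, pullback.fst a b ≫ R.outl, pullback.fst a b ≫ R.outr⟩, ?_⟩,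
    ⟨pullback.fst a b, rfl, rfl⟩, ⟨pullback.snd a b, ?_, ?_⟩, ?_⟩
  · intro Z x y hl hr
    rw [← cancel_mono (pullback.fst a b)]
    exact R.jointly_monic _ _ (by simpa using hl) (by simpa using hr)
  · simpa using hfst.symm
  · simpa using hsnd.symm
  · rintro Q ⟨h, hl, hr⟩ ⟨k, kl, kr⟩
    refine ⟨pullback.lift h k ?_, ?_, ?_⟩
    · ext
      · simp [a, b, reassoc_of% hl, kl]
      · simp [a, b, reassoc_of% hr, kr]
    · simp [hl]
    · simp [hr]

/-- The inverse image of a relation along `f ⨯ f`. -/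
lemma exists_preimage [HasLimits C] {X Y : C} (f : X ⟶ Y) (S : RelOver Y) :
    ∃ P : RelOver X, ∀ Q : GraphOver X, RelatesAlong f f Q S.toGraphOver ↔ Q ≤ P.toGraphOver := by
  let T : RelOver X := ⟨⟨X ⨯ X, Limits.prod.fst, Limits.prod.snd⟩, fun _ _ _ hl hr => by
    ext
    · exact hl
    · exact hr⟩
  obtain ⟨P, -, hP, hPmax⟩ := exists_restriction f f T S
  exact ⟨P, fun Q => ⟨hPmax Q ⟨Limits.prod.lift Q.outl Q.outr, by simp [T], by simp [T]⟩,
    fun h => hP.le_trans h⟩⟩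

end RelOver

end RelatesAlong

section Simulations

variable {C : Type u} [Category.{v} C]

/-! ### The similarity preorder -/

lemma RelationLifting.mono {F : C ⥤ C} (Fbar : RelationLifting F) {X : C} {R S : RelOver X}
    (h : R ≤ S) : Fbar.obj R ≤ Fbar.obj S := by
  have := Fbar.map (𝟙 X) (RelatesAlong.of_le h)
  rw [F.map_id] at this
  exact RelatesAlong.le this

lemma BifunctorLifting.anti_left {B : Cᵒᵖ ⥤ C ⥤ C} (Bbar : BifunctorLifting B) {X Y : C}
    {R R' : RelOver X} (h : R ≤ R') (S : RelOver Y) : Bbar.obj R' S ≤ Bbar.obj R S := by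
  have := Bbar.map (𝟙 X) (𝟙 Y) (RelatesAlong.of_le h) (isGraphMap_id S.toGraphOver)
  rw [op_id, B.map_id, NatTrans.id_app, CategoryTheory.Functor.map_id, Category.comp_id] at this
  exact RelatesAlong.le this

lemma BifunctorLifting.mono_right {B : Cᵒᵖ ⥤ C ⥤ C} (Bbar : BifunctorLifting B) {X Y : C}
    (R : RelOver X) {S S' : RelOver Y} (h : S ≤ S') : Bbar.obj R S ≤ Bbar.obj R S' := by
  have := Bbar.map (𝟙 X) (𝟙 Y) (isGraphMap_id R.toGraphOver) (RelatesAlong.of_le h)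
  rw [op_id, B.map_id, NatTrans.id_app, CategoryTheory.Functor.map_id, Category.comp_id] at this
  exact RelatesAlong.le this

lemma exists_greatest_simulation [HasLimits C] [WellPowered.{v} C] {F : C ⥤ C}
    (Fbar : RelationLifting F) {X : C} (c : X ⟶ F.obj X) :
    ∃ R : RelOver X, IsSimulation Fbar c R ∧ ∀ S, IsSimulation Fbar c S → S ≤ R := by
  choose Φ hΦ using fun S : RelOver X => RelOver.exists_preimage c (Fbar.obj S)
  obtain ⟨R, hR, hmax⟩ := RelOver.exists_greatest_postfixed Φ fun S T h =>
    (hΦ T _).1 (((hΦ S _).2 le_rfl).trans_le (Fbar.mono h))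
  exact ⟨R, (hΦ R _).2 hR, fun S hS => hmax S ((hΦ S _).1 hS)⟩

lemma IsWeakening.isWeakSimulation_iff {F : C ⥤ C} {Fbar : RelationLifting F} {X : C}
    {c c' : X ⟶ F.obj X} (hw : IsWeakening Fbar c c') {R : RelOver X} :
    IsWeakSimulation Fbar c c' R ↔ IsSimulation Fbar c' R :=
  ⟨And.left, fun h => ⟨h, (hw R).1 h⟩⟩

lemma IsWeakening.exists_isWeakSimilarity [HasLimits C] [WellPowered.{v} C] {F : C ⥤ C}
    {Fbar : RelationLifting F} {X : C} {c c' : X ⟶ F.obj X} (hw : IsWeakening Fbar c c') :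
    ∃ R : RelOver X, IsWeakSimilarity Fbar c c' R := by
  obtain ⟨R, hR, hmax⟩ := exists_greatest_simulation Fbar c'
  exact ⟨R, hw.isWeakSimulation_iff.2 hR, fun S hS => hmax S hS.1⟩

variable [HasPullbacks C] [HasBinaryProducts C] [HasStrongEpiMonoFactorisations C]
  {B : Cᵒᵖ ⥤ C ⥤ C} {p : BifunctorPreorder B} {Bbar : BifunctorLifting B}

lemma BifunctorLifting.GoodForSimulations.isSimulation_diag (hB : Bbar.GoodForSimulations p)
    {X : C} (c : X ⟶ (B.obj (op X)).obj X) :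
    IsSimulation (Bbar.atDiag X) c (RelOver.diag X) :=
  (RelatesAlong.diag c).trans_le (hB.reflexive X X)

lemma BifunctorLifting.GoodForSimulations.isSimulation_comp (hB : Bbar.GoodForSimulations p)
    {X : C} {c : X ⟶ (B.obj (op X)).obj X} {R S : RelOver X}
    (hR : IsSimulation (Bbar.atDiag X) c R) (hS : IsSimulation (Bbar.atDiag X) c S) :
    IsSimulation (Bbar.atDiag X) c (R.comp S) :=
  RelatesAlong.of_dagger <|
    ((RelatesAlong.comp (GraphOver.pushforward_le_iff.1 hR)
      (GraphOver.pushforward_le_iff.1 hS)).trans_le (GraphOver.le_dagger _)).trans_le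
        (hB.comp_le _ _ _)

end Simulations

section HoweClosure

variable {C : Type u} [Category.{v} C]

/-! ### The Howe closure -/

section

variable [HasBinaryProducts C] [HasStrongEpiMonoFactorisations C] {F : C ⥤ C}

/-- The relation `a⋆ (F̄ R)` on an algebra `(A, a)`, where `F̄` is the canonical lifting: the pairs
obtained by applying an operation to related arguments. It is kept as a graph. -/
abbrev compatibleGraph (A : Endofunctor.Algebra F) (R : RelOver A.a) : GraphOver A.a :=
  ((canonicalLifting F).obj R).toGraphOver.pushforward A.str

lemma compatibleGraph_mono (A : Endofunctor.Algebra F) {R S : RelOver A.a} (h : R ≤ S) :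
    compatibleGraph A R ≤ compatibleGraph A S :=
  GraphOver.pushforward_le_iff.2
    (RelatesAlong.le_trans ((canonicalLifting F).mono h) (RelatesAlong.pushforward _ _))

/-- The edges of a congruence form an algebra for which the projections are homomorphisms. -/
lemma IsCongruence.exists_algebra {A : Endofunctor.Algebra F} {R : RelOver A.a}
    (hR : IsCongruence A R) :
    ∃ s : F.obj R.edge ⟶ R.edge,
      F.map R.outl ≫ A.str = s ≫ R.outl ∧ F.map R.outr ≫ A.str = s ≫ R.outr := by
  have h : RelatesAlong A.str A.str (R.toGraphOver.map F) R.toGraphOver :=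
    RelatesAlong.le_trans (GraphOver.le_dagger _) hR
  obtain ⟨s, sl, sr⟩ := h
  exact ⟨s, sl.symm, sr.symm⟩

lemma IsCongruence.isReflexive {I : Endofunctor.Algebra F} (hI : IsInitial I) {R : RelOver I.a}
    (hR : IsCongruence I R) : R.IsReflexive := by
  obtain ⟨s, sl, sr⟩ := hR.exists_algebra
  let T : Endofunctor.Algebra F := ⟨R.edge, s⟩
  let πl : T ⟶ I := { f := R.outl, h := sl }
  let πr : T ⟶ I := { f := R.outr, h := sr }
  exact ⟨(hI.to T).f, congrArg Endofunctor.Algebra.Hom.f (hI.hom_ext (hI.to T ≫ πl) (𝟙 I)),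
    congrArg Endofunctor.Algebra.Hom.f (hI.hom_ext (hI.to T ≫ πr) (𝟙 I))⟩

/-- A congruence is closed under the evaluation of terms. -/
lemma IsCongruence.isGraphMap_evalAlg {L : C ⥤ Endofunctor.Algebra F}
    (adj : L ⊣ Endofunctor.Algebra.forget F) {A : Endofunctor.Algebra F} {R : RelOver A.a}
    (hR : IsCongruence A R) :
    IsGraphMap (evalAlg adj A) ((canonicalLifting (freeMonad L)).obj R).toGraphOver
      R.toGraphOver := by
  obtain ⟨s, sl, sr⟩ := hR.exists_algebra
  let T : Endofunctor.Algebra F := ⟨R.edge, s⟩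
  let πl : T ⟶ A := { f := R.outl, h := sl }
  let πr : T ⟶ A := { f := R.outr, h := sr }
  exact IsGraphMap.of_dagger ⟨evalAlg adj T,
    (congrArg Endofunctor.Algebra.Hom.f (adj.counit.naturality πl)).symm,
    (congrArg Endofunctor.Algebra.Hom.f (adj.counit.naturality πr)).symm⟩

/-- `ι⋆ (F̄ H)` is reflexive for reflexive `H`, because the structure of an initial algebra is
invertible. -/
lemma diag_le_compatibleGraph {I : Endofunctor.Algebra F} (hI : IsInitial I) {R : RelOver I.a}
    (hR : R.IsReflexive) : (RelOver.diag I.a).toGraphOver ≤ compatibleGraph I R := by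
  let i : I.a ⟶ F.obj I.a := Endofunctor.Algebra.Initial.strInv hI
  have h : RelatesAlong i i (RelOver.diag I.a).toGraphOver
      ((RelOver.diag I.a).toGraphOver.map F) := by
    have hi : i ≫ F.map (𝟙 I.a) = 𝟙 I.a ≫ i := by simp
    exact ⟨i, hi, hi⟩
  have hmap := (RelatesAlong.of_le hR).map F
  rw [F.map_id] at hmap
  have := ((h.trans_le hmap.le).trans_le (GraphOver.le_dagger _)).trans
    (RelatesAlong.pushforward I.str _)
  rw [Endofunctor.Algebra.Initial.left_inv hI] at this
  exact this.le

variable [HasPullbacks C]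

/-- `H` is the Howe closure of the relation `R` on the algebra `(A, a)`: the least relation with
`a⋆ (F̄ H) • R ≤ H`. -/
structure IsHoweClosure (A : Endofunctor.Algebra F) (R H : RelOver A.a) : Prop where
  comp_le : (compatibleGraph A H).comp R.toGraphOver ≤ H.toGraphOver
  le_dagger : H ≤ ((compatibleGraph A H).comp R.toGraphOver).dagger
  le_of_comp_le : ∀ P : RelOver A.a,
    (compatibleGraph A P).comp R.toGraphOver ≤ P.toGraphOver → H ≤ P

namespace IsHoweClosure

variable {A : Endofunctor.Algebra F} {R H : RelOver A.a}

lemma isCongruence (h : IsHoweClosure A R H) (hR : R.IsReflexive) : IsCongruence A H :=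
  _root_.le_trans (GraphOver.le_comp_of_diag_le_right hR _) h.comp_le

lemma comp_self_le (h : IsHoweClosure A R H) (hepi : StrongEpisPullbackStable C)
    (hR : R.toGraphOver.comp R.toGraphOver ≤ R.toGraphOver) :
    H.toGraphOver.comp R.toGraphOver ≤ H.toGraphOver := by
  refine _root_.le_trans (GraphOver.comp_mono h.le_dagger le_rfl) (GraphOver.dagger_comp_le hepi ?_)
  calc ((compatibleGraph A H).comp R.toGraphOver).comp R.toGraphOver
      ≤ (compatibleGraph A H).comp (R.toGraphOver.comp R.toGraphOver) :=
        GraphOver.comp_assoc_le _ _ _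
    _ ≤ (compatibleGraph A H).comp R.toGraphOver := GraphOver.comp_mono le_rfl hR
    _ ≤ H.toGraphOver := h.comp_le

lemma le (h : IsHoweClosure A R H) (hA : IsInitial A) (hR : R.IsReflexive) : R ≤ H :=
  _root_.le_trans (α := GraphOver A.a) (GraphOver.le_comp_of_diag_le_left
    (diag_le_compatibleGraph hA ((h.isCongruence hR).isReflexive hA)) _) h.comp_le

end IsHoweClosure

end

lemma exists_isHoweClosure [HasLimits C] [WellPowered.{v} C] {F : C ⥤ C}
    (A : Endofunctor.Algebra F) (R : RelOver A.a) : ∃ H : RelOver A.a, IsHoweClosure A R H := by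
  obtain ⟨H, h1, h2, h3⟩ := RelOver.exists_least_prefixed
    (fun S => ((compatibleGraph A S).comp R.toGraphOver).dagger) fun S T h =>
      GraphOver.dagger_le (_root_.le_trans
        (GraphOver.comp_mono (compatibleGraph_mono A h) le_rfl) (GraphOver.le_dagger _))
  exact ⟨H, _root_.le_trans (GraphOver.le_dagger _) h1, h2,
    fun P hP => h3 P (GraphOver.dagger_le hP)⟩

end HoweClosure

section Compositionality

variable {C : Type u} [Category.{v} C] [HasBinaryProducts C] [HasBinaryCoproducts C]
  [HasStrongEpiMonoFactorisations C]
  {V : C} {Sig Sig' : C ⥤ C} {L : C ⥤ Endofunctor.Algebra Sig} {B : Cᵒᵖ ⥤ C ⥤ C}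

/-! ### Relating the operational model to its weakening -/

lemma isGraphMap_codiag {X : C} (R : RelOver X) :
    IsGraphMap (coprod.desc (𝟙 X) (𝟙 X)) (R.coprod R).toGraphOver R.toGraphOver :=
  IsGraphMap.of_dagger ⟨coprod.desc (𝟙 _) (𝟙 _),
    (by ext <;> simp : coprod.desc (𝟙 R.edge) (𝟙 R.edge) ≫ R.outl =
      Limits.coprod.map R.outl R.outl ≫ coprod.desc (𝟙 X) (𝟙 X)),
    (by ext <;> simp : coprod.desc (𝟙 R.edge) (𝟙 R.edge) ≫ R.outr =
      Limits.coprod.map R.outr R.outr ≫ coprod.desc (𝟙 X) (𝟙 X))⟩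

/-- For a reflexive congruence `H` on `A`, the composite of the law with evaluation in `A` is a
morphism of relations `Σ̄ (H ⨯ B̄ (H, H)) ⟶ B̄ (H, H)`. -/
lemma Law.isGraphMap_step (e : Sig ≅ (Functor.const C).obj V ⨿ Sig')
    (adj : L ⊣ Endofunctor.Algebra.forget Sig) {ρ : Law V Sig L B} {Bbar : BifunctorLifting B}
    (hρ : ρ.Lifting Bbar) {A : Endofunctor.Algebra Sig} {H : RelOver A.a}
    (hH : IsCongruence A H) (hrefl : H.IsReflexive) :
    IsGraphMap (ρ.step e adj A) ((canonicalLifting Sig).obj (H.prod (Bbar.obj H H))).toGraphOver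
      (Bbar.obj H H).toGraphOver := by
  -- Reflexivity of `H` turns the point of `A` into a point of `H` over it.
  let pt : V ⟶ A.a := (pointed e A).hom
  have hpt : RelatesAlong pt pt (RelOver.diag V).toGraphOver H.toGraphOver :=
    (RelatesAlong.diag pt).trans_le hrefl
  let P : Under (Rel.diag V) := Under.mk (Y := (⟨A.a, H⟩ : Rel C)) (Rel.homMk pt hpt)
  have h1 := Rel.isGraphMap (hρ.app P ⟨A.a, H⟩)
  rw [hρ.app_base] at h1
  have h2 : IsGraphMap ((freeMonad L).map (coprod.desc (𝟙 A.a) (𝟙 A.a)) ≫ evalAlg adj A)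
      ((canonicalLifting (freeMonad L)).obj (H.coprod H)).toGraphOver H.toGraphOver :=
    RelatesAlong.trans ((canonicalLifting (freeMonad L)).map _ (isGraphMap_codiag H))
      (hH.isGraphMap_evalAlg adj)
  have h3 := Bbar.map (𝟙 A.a) _ (BifunctorLifting.isGraphMap_id H.toGraphOver) h2
  rw [op_id, B.map_id, NatTrans.id_app, Category.id_comp, Functor.map_comp] at h3
  exact RelatesAlong.trans h1 h3

/-- The inductive step of Howe's method: if `P ≤ H` relates `γ` to `γ'` in `B̄ (H, H)`, then so does
`ι⋆ (Σ̄ P)`. -/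
lemma relatesAlong_compatibleGraph_of_isLaxBialgebra [HasPullbacks C]
    (e : Sig ≅ (Functor.const C).obj V ⨿ Sig')
    (adj : L ⊣ Endofunctor.Algebra.forget Sig) {p : BifunctorPreorder B}
    {Bbar : BifunctorLifting B} (hB : Bbar.GoodForSimulations p)
    {ρ : Law V Sig L B} (hρ : ρ.Lifting Bbar) {A : Endofunctor.Algebra Sig}
    {γ γ' : A.a ⟶ (B.obj (op A.a)).obj A.a}
    (hγ : A.str ≫ γ = Sig.map (prod.lift (𝟙 _) γ) ≫ ρ.step e adj A)
    (hlax : ρ.IsLaxBialgebra e adj p A γ') {H P : RelOver A.a}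
    (hH : IsCongruence A H) (hrefl : H.IsReflexive) (hPH : P ≤ H)
    (hP : RelatesAlong γ γ' P.toGraphOver (Bbar.obj H H).toGraphOver) :
    RelatesAlong γ γ' (compatibleGraph A P) (Bbar.obj H H).toGraphOver := by
  have h1 : RelatesAlong (Sig.map (prod.lift (𝟙 _) γ)) (Sig.map (prod.lift (𝟙 _) γ'))
      ((canonicalLifting Sig).obj P).toGraphOver
      ((canonicalLifting Sig).obj (H.prod (Bbar.obj H H))).toGraphOver :=
    ((((RelatesAlong.of_le hPH).prodLift hP).map Sig).trans_le
      (GraphOver.le_dagger _)).of_dagger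
  obtain ⟨k, kl, kr⟩ := h1.trans (Law.isGraphMap_step e adj hρ hH hrefl)
  -- The law yields only `ρ_A · Σ⟨id, γ'⟩` on the right, and goodness replaces it by the larger
  -- `γ' · a`.
  let T : GraphOver ((B.obj (op A.a)).obj A.a) :=
    ⟨((canonicalLifting Sig).obj P).edge, (compatibleGraph A P).outl ≫ γ,
      (compatibleGraph A P).outr ≫ γ'⟩
  have hT : T ≤ (Bbar.obj H H).toGraphOver := by
    refine hB.good H H T ⟨k, ?_, ?_⟩
    · rw [kl, ← hγ]
      exact (Category.assoc _ _ _).symm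
    · rw [kr]
      have := (p A.a A.a).precomp ((canonicalLifting Sig).obj P).outr _ _ hlax
      rw [← Category.assoc _ A.str] at this
      exact this
  exact hT

end Compositionality

end HOGSOS

end

theorem mainTheorem1 {C : Type u} [Category.{v} C]
    [HasLimits C] [HasColimits C] [WellPowered.{v} C]
    (hepi : HOGSOS.StrongEpisPullbackStable C) (hdist : HOGSOS.IsLocallyDistributive C)
    {V : C} {Sig Sig' : C ⥤ C} (e : Sig ≅ (Functor.const C).obj V ⨿ Sig')
    (hSig : HOGSOS.PreservesStrongEpis Sig)
    {L : C ⥤ Endofunctor.Algebra Sig} (adj : L ⊣ Endofunctor.Algebra.forget Sig)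
    {B : Cᵒᵖ ⥤ C ⥤ C} (p : HOGSOS.BifunctorPreorder B)
    (Bbar : HOGSOS.BifunctorLifting B) (hB : Bbar.GoodForSimulations p)
    (ρ : HOGSOS.Law V Sig L B) (hρ : Nonempty (ρ.Lifting Bbar))
    {I : Endofunctor.Algebra Sig} (hI : IsInitial I)
    (γ' : I.a ⟶ (B.obj (op I.a)).obj I.a)
    (hweak : HOGSOS.IsWeakening (Bbar.atDiag I.a) (ρ.operationalModel e adj hI) γ')
    (hlax : ρ.IsLaxBialgebra e adj p I γ') :
    (∃ R : HOGSOS.RelOver I.a,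
      HOGSOS.IsWeakSimilarity (Bbar.atDiag I.a) (ρ.operationalModel e adj hI) γ' R) ∧
    ∀ R : HOGSOS.RelOver I.a,
      HOGSOS.IsWeakSimilarity (Bbar.atDiag I.a) (ρ.operationalModel e adj hI) γ' R →
        HOGSOS.IsCongruence I R := by
  refine ⟨hweak.exists_isWeakSimilarity, fun R hR => ?_⟩
  set γ := ρ.operationalModel e adj hI
  have hγ : I.str ≫ γ = Sig.map (prod.lift (𝟙 _) γ) ≫ ρ.step e adj I :=
    (HOGSOS.primRec_unique hI _ _).2 rfl
  have hrefl : R.IsReflexive := hR.le _ (hweak.isWeakSimulation_iff.2 (hB.isSimulation_diag γ'))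
  have htrans : R.comp R ≤ R := hR.le _ (hweak.isWeakSimulation_iff.2
    (hB.isSimulation_comp hR.isWeakSimulation.1 hR.isWeakSimulation.1))
  obtain ⟨H, hH⟩ := HOGSOS.exists_isHoweClosure I R
  have hcong := hH.isCongruence hrefl
  have hHrefl := hcong.isReflexive hI
  have hHR : H.comp R ≤ H := HOGSOS.GraphOver.dagger_le
    (hH.comp_self_le hepi (le_trans (HOGSOS.GraphOver.le_dagger _) htrans))
  -- The part of `H` on which `γ` and `γ'` are related in `B̄ (H, H)` is all of `H`.
  obtain ⟨P, hPH, hP, hPmax⟩ := HOGSOS.RelOver.exists_restriction γ γ' H (Bbar.obj H H)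
  have hHP : H ≤ P := by
    refine hH.le_of_comp_le P (hPmax _ ?_ ?_)
    · exact le_trans
        (HOGSOS.GraphOver.comp_mono (HOGSOS.compatibleGraph_mono I hPH) le_rfl) hH.comp_le
    · have hstep := HOGSOS.relatesAlong_compatibleGraph_of_isLaxBialgebra e adj hB hρ.some hγ hlax
        hcong hHrefl hPH hP
      exact (((hstep.comp (HOGSOS.GraphOver.pushforward_le_iff.1 hR.isWeakSimulation.1)).trans_le
        (HOGSOS.GraphOver.le_dagger _)).trans_le (hB.comp_le H H R)).trans_le
          (Bbar.mono_right H hHR)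
  have hmixed : HOGSOS.IsMixedSimulation (Bbar.atDiag I.a) γ γ' H :=
    (hP.le_trans hHP).trans_le (Bbar.anti_left hHrefl H)
  have hHle : H ≤ R := hR.le H ⟨(hweak H).2 hmixed, hmixed⟩
  exact le_trans (HOGSOS.compatibleGraph_mono I (hH.le hI hrefl)) (le_trans hcong hHle)
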